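/- **Setting.** All graphs are finite. A causal Bayesian network (CBN) over a DAG $G$ consists of a measurable space $X_a$ for each node $a$ and a Markov kernel $p(a\mid \mathrm{pa}_G(a))$ from $\prod_{b\in \mathrm{pa}_G(a)}X_b$ to $X_a$ for each node $a$. The interventional distribution $p(\,\cdot\mid do(S=z))$ is the truncated product $\prod_{a\notin S}p(a\mid \mathrm{pa}_G(a))$ with the values of the nodes in $S$ fixed to $z$. An ADMG is a DAG together with bidirected edges $a\leftrightarrow b$ between distinct nodes. Let $L'$ be a DAG whose nodes are divided into endogenous nodes $V$ and exogenous nodes $U$, the latter having no parents. The latent projection of $L'$ is the ADMG on $V$ in which $a\to b$ iff $L'$ has a directed path from $a$ to $b$ with all intermediate nodes in $U$, and $a\leftrightarrow b$ iff $a\ne b$ and some $u\in U$ has directed paths to $a$ and to $b$ with all intermediate nodes in $U$. A CBN over an ADMG $L$ is a CBN over some such DAG $L'$ with latent projection $L$. A DAG $H'$ is a graphical abstraction of a DAG $L'$ if it results from $L'$ by a finite sequence of the following operations: (i) deleting a node that does not have outgoing edges to two different nodes, and adding edges from all its parents to all its children; (ii) merging two nodes into one, which inherits all their incoming and outgoing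 edges (edges between the two disappear). Each node of $H'$ thus stands for a cluster of nodes of $L'$. An ADMG $H$ with node set $V^H$ is a graphical abstraction between ADMGs of the ADMG $L$ if there are DAGs $L'',H''$ with exogenous nodes as above, with latent projections $L$ and $H$, such that $H''$ is a graphical abstraction of $L''$ and each node $C\in V^H$ stands for a cluster of nodes of $L$. These clusters are disjoint; the variable $C$ has domain $Z_C=\prod_{a\in C}X_a$. **Statement.** Consider a CBN with interventional distributions $p$ over an ADMG $L$, and let $H$ be a graphical abstraction between ADMGs of $L$. Then there are finitely many independent random variables $U=(U_i)_{i\in I}$ with joint law $p(U)=\bigotimes_{i\in I}p(U_i)$, subsets $U_C\subseteq U$ for $C\in V^H$, and Markov kernels $p(C\mid \mathrm{pa}_H(C),U_C)$ from $\prod_{D\in \mathrm{pa}_H(C)}Z_D\times\prod_{U_i\in U_C}Y_i$ to $Z_C$ (where $Y_i$ is the domain of $U_i$ and $\mathrm{pa}_H$ denotes parents along directed edges) such that: 1. for all $C\neq C'$ in $V^H$, $U_C\cap U_{C'}\neq\emptyset$ if and only if $H$ has a bidirected edge $C\leftrightarrow C'$; 2. for every set $S\subseteq V^H$ of intervened nodes,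 and all values of these nodes, $$p(V^H\setminus S\mid do(S))=\int_U p(U)\prod_{C\in V^H\setminus S}p(C\mid \mathrm{pa}_H(C),U_C)\,dU .$$ In particular, for every single node $A\in V^H$, $$p(V^H\setminus\{A\}\mid do(A))=\int_U p(U)\prod_{C\in V^H\setminus\{A\}}p(C\mid \mathrm{pa}_H(C),U_C)\,dU .$$ -/

import Mathlib

open MeasureTheory ProbabilityTheory

universe u v w x

/-! ### Directed acyclic graphs, mixed graphs and latent projections -/

/-- A directed acyclic graph on the nodes `N`. -/
structure DAG (N : Type u) where
  /-- `Adj a b` means that there is an edge from `a` to `b`. -/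
  Adj : N → N → Prop
  acyclic : ∀ a, ¬ Relation.TransGen Adj a a

/-- An acyclic directed mixed graph: a directed acyclic graph together with bidirected edges. -/
structure ADMG (V : Type u) extends DAG V where
  /-- `bi a b` means that there is a bidirected edge between `a` and `b`. -/
  bi : V → V → Prop
  bi_symm : ∀ a b, bi a b → bi b a
  bi_irrefl : ∀ a, ¬ bi a a

/-- The parents of a node. -/
def DAG.pa {N : Type u} (G : DAG N) (b : N) : Set N := {a | G.Adj a b}

/-- `G.LatentPath a b`: there is a directed path of positive length from `a` to `b`
all of whose intermediate nodes are latent, i.e. belong to the summand `U`. -/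
inductive DAG.LatentPath {V : Type u} {U : Type v} (G : DAG (V ⊕ U)) : V ⊕ U → V ⊕ U → Prop
  | edge {a b : V ⊕ U} : G.Adj a b → G.LatentPath a b
  | cons {a b : V ⊕ U} {l : U} : G.Adj a (Sum.inr l) → G.LatentPath (Sum.inr l) b →
      G.LatentPath a b

/-- `G`, whose nodes are divided into the endogenous nodes `V` and the nodes `U`, has exogenous
nodes `U` (they have no parents) and latent projection `L`: `a → b` in `L` iff some directed path
leads from `a` to `b` through latent nodes, and `a ↔ b` in `L` iff `a ≠ b` have a common latent
source from which directed paths through latent nodes lead to `a` and to `b`. -/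
structure DAG.HasLatentProjection {V : Type u} {U : Type v} (G : DAG (V ⊕ U)) (L : ADMG V) :
    Prop where
  exogenous : ∀ (a : V ⊕ U) (l : U), ¬ G.Adj a (Sum.inr l)
  dir_iff : ∀ a b : V, L.Adj a b ↔ G.LatentPath (Sum.inl a) (Sum.inl b)
  bi_iff : ∀ a b : V, L.bi a b ↔
    a ≠ b ∧ ∃ l : U, G.LatentPath (Sum.inr l) (Sum.inl a) ∧ G.LatentPath (Sum.inr l) (Sum.inl b)

/-! ### Graphical abstractions -/

/-- A directed graph whose nodes are clusters (sets) of elements of `N`. -/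
structure ClusterGraph (N : Type u) where
  nodes : Set (Set N)
  Adj : Set N → Set N → Prop

namespace ClusterGraph

variable {N : Type u}

/-- A directed acyclic graph, each node being regarded as a one-element cluster. -/
def ofDAG (G : DAG N) : ClusterGraph N where
  nodes := Set.range fun a => {a}
  Adj A B := ∃ a b, A = {a} ∧ B = {b} ∧ G.Adj a b

/-- Delete the node `A` and add edges from all of its parents to all of its children. -/
def delete (K : ClusterGraph N) (A : Set N) : ClusterGraph N where
  nodes := K.nodes \ {A}
  Adj B C := B ≠ A ∧ C ≠ A ∧ B ≠ C ∧ (K.Adj B C ∨ (K.Adj B A ∧ K.Adj A C))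

open Classical in
/-- The node that represents `E` after `A` and `B` have been merged into `A ∪ B`. -/
noncomputable def mergeMap (A B E : Set N) : Set N := if E = A ∨ E = B then A ∪ B else E

/-- Merge the nodes `A` and `B` into the node `A ∪ B`, which inherits all incoming and all
outgoing edges of `A` and `B`; the edges between `A` and `B` disappear. -/
def merge (K : ClusterGraph N) (A B : Set N) : ClusterGraph N where
  nodes := mergeMap A B '' K.nodes
  Adj C D := C ≠ D ∧ ∃ C₀ D₀, K.Adj C₀ D₀ ∧ mergeMap A B C₀ = C ∧ mergeMap A B D₀ = D

/-- The graphs that result from `G` by a finite sequence of the two operations: deleting a node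
that does not have two outgoing edges to different nodes, and merging two nodes. -/
inductive Reachable (G : DAG N) : ClusterGraph N → Prop
  | start : Reachable G (ofDAG G)
  | delete {K : ClusterGraph N} {A : Set N} : Reachable G K → A ∈ K.nodes →
      (∀ B C, K.Adj A B → K.Adj A C → B = C) → Reachable G (K.delete A)
  | merge {K : ClusterGraph N} {A B : Set N} : Reachable G K → A ∈ K.nodes → B ∈ K.nodes →
      A ≠ B → Reachable G (K.merge A B)

end ClusterGraph

/-- The DAG `H` is a graphical abstraction of the DAG `G`, where each node `a` of `H` stands for
the cluster `c a` of nodes of `G` that have been merged into it. -/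
def IsGraphicalAbstraction {N : Type u} {N' : Type v} (G : DAG N) (H : DAG N') (c : N' → Set N) :
    Prop :=
  ∃ K : ClusterGraph N, ClusterGraph.Reachable G K ∧ Function.Injective c ∧
    Set.range c = K.nodes ∧ ∀ a b, H.Adj a b ↔ K.Adj (c a) (c b)

/-- The ADMG `H` is a graphical abstraction between ADMGs of the ADMG `L`, where each node `C` of
`H` stands for the cluster `cl C` of nodes of `L`: there are DAGs `L'` and `H'` with finitely many
exogenous nodes, whose latent projections are `L` and `H`, such that `H'` is a graphical
abstraction of `L'`. -/
def IsADMGAbstraction {V : Type u} {W : Type v} (L : ADMG V) (H : ADMG W) (cl : W → Set V) :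
    Prop :=
  ∃ (m n : ℕ) (L' : DAG (V ⊕ Fin m)) (H' : DAG (W ⊕ Fin n)) (c : W ⊕ Fin n → Set (V ⊕ Fin m)),
    L'.HasLatentProjection L ∧ H'.HasLatentProjection H ∧ IsGraphicalAbstraction L' H' c ∧
      ∀ C : W, c (Sum.inl C) = Sum.inl '' cl C

/-! ### Causal Bayesian networks and interventional distributions -/

/-- A finite directed acyclic graph has a topological order. -/
theorem DAG.exists_topological_order {N : Type u} [Finite N] (G : DAG N) :
    ∃ l : List N, l.Nodup ∧ (∀ a, a ∈ l) ∧ l.Pairwise fun a b => ¬ G.Adj b a := by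
  classical
  have := Fintype.ofFinite N
  have hpo : IsPartialOrder N (Relation.ReflTransGen G.Adj) :=
    { refl := fun _ => Relation.ReflTransGen.refl
      trans := fun _ _ _ => Relation.ReflTransGen.trans
      antisymm := fun a b hab hba => by
        rcases Relation.reflTransGen_iff_eq_or_transGen.1 hab with h | h
        · exact h.symm
        · exact absurd (h.trans_left hba) (G.acyclic a) }
  obtain ⟨s, hs, hrs⟩ := extend_partialOrder (Relation.ReflTransGen G.Adj)
  refine ⟨Finset.univ.sort s, Finset.sort_nodup _ _, fun a => by simp, ?_⟩
  refine ((Finset.pairwise_sort Finset.univ s).and (Finset.sort_nodup _ _)).imp ?_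
  rintro a b ⟨hab, hne⟩ hadj
  exact hne (antisymm_of s hab (hrs _ _ (Relation.ReflTransGen.single hadj)))

/-- A topological order of the nodes: a list of all nodes in which parents precede children. -/
noncomputable def DAG.order {N : Type u} [Finite N] (G : DAG N) : List N :=
  G.exists_topological_order.choose

/-- A causal Bayesian network over the DAG `G` with domains `X a`: a Markov kernel
`p(a | pa(a))` for each node `a`. -/
structure CBN {N : Type u} (G : DAG N) (X : N → Type x) [∀ a, MeasurableSpace (X a)] where
  mech : ∀ a, Kernel (∀ b : G.pa a, X b) (X a)
  markov : ∀ a, IsMarkovKernel (mech a)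

namespace CBN

variable {N : Type u} {G : DAG N} {X : N → Type x} [∀ a, MeasurableSpace (X a)]

open Classical in
/-- Sample the value of the node `a` from `p(a | pa(a))`, leaving all other values unchanged. -/
noncomputable def step (M : CBN G X) (a : N) : Kernel (∀ b, X b) (∀ b, X b) :=
  (Kernel.id ×ₖ (M.mech a).comap (fun z (b : G.pa a) => z b) (by fun_prop)).map
    fun q => Function.update q.1 a q.2

/-- Sample the nodes of a list one after the other. -/
noncomputable def run (M : CBN G X) : List N → Kernel (∀ b, X b) (∀ b, X b)
  | [] => Kernel.id
  | a :: l => M.run l ∘ₖ M.step a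

open Classical in
/-- The joint distribution of all variables under the intervention `do(S)` that sets every node
`a ∈ S` to `z a`, i.e. the truncated product `∏_{a ∉ S} p(a | pa(a))`: the nodes outside `S` are
sampled from their mechanisms in topological order. The values `z a` with `a ∉ S` are irrelevant,
because they are overwritten before they are read. -/
noncomputable def doDist [Finite N] (M : CBN G X) (S : Set N) (z : ∀ a, X a) :
    Measure (∀ a, X a) :=
  M.run (G.order.filter fun a => a ∉ S) z

open Classical in
theorem measurable_update_pair (a : N) :
    Measurable fun q : (∀ b, X b) × X a => Function.update q.1 a q.2 := by
  refine measurable_pi_lambda _ fun b => ?_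
  by_cases h : b = a
  · subst h
    simpa using measurable_snd
  · simp only [Function.update_of_ne h]
    fun_prop

instance isMarkovKernel_step (M : CBN G X) (a : N) : IsMarkovKernel (M.step a) := by
  classical
  have := M.markov a
  exact Kernel.IsMarkovKernel.map _ (measurable_update_pair a)

instance isMarkovKernel_run (M : CBN G X) (l : List N) : IsMarkovKernel (M.run l) := by
  induction l with
  | nil => exact inferInstanceAs (IsMarkovKernel Kernel.id)
  | cons a l ih => exact inferInstanceAs (IsMarkovKernel (M.run l ∘ₖ M.step a))

instance isProbabilityMeasure_doDist [Finite N] (M : CBN G X) (S : Set N) (z : ∀ a, X a) :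
    IsProbabilityMeasure (M.doDist S z) := by
  unfold doDist; infer_instance

theorem run_cons (M : CBN G X) (a : N) (l : List N) (z : ∀ a, X a) [DecidableEq N] :
    M.run (a :: l) z = (M.mech a fun b => z b).bind fun t => M.run l (Function.update z a t) := by
  classical
  have := M.markov a
  have hu : Measurable fun t : X a => Function.update z a t := measurable_update z
  have hs : M.step a z = (M.mech a fun b => z b).map fun t => Function.update z a t := by
    rw [step, Kernel.map_apply _ (measurable_update_pair a), Kernel.prod_apply, Kernel.id_apply,
      Measure.dirac_prod, Kernel.comap_apply,
      Measure.map_map (measurable_update_pair a) measurable_prodMk_left]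
    congr! 2
    simp only [Function.comp]
    congr!
  rw [run, Kernel.comp_apply, hs, Measure.bind, Measure.map_map (M.run l).measurable hu]
  rfl

theorem run_congr (M : CBN G X) (l : List N) (hl : l.Pairwise fun a b => ¬ G.Adj b a)
    (z z' : ∀ a, X a) (h : ∀ a, a ∉ l → z a = z' a) : M.run l z = M.run l z' := by
  classical
  induction l generalizing z z' with
  | nil => rw [show z = z' from funext fun a => h a (by simp)]
  | cons a l ih =>
    rw [run_cons, run_cons]
    rw [List.pairwise_cons] at hl
    have : (fun b : G.pa a => z b) = fun b : G.pa a => z' b := by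
      funext b
      refine h _ ?_
      rintro hb
      rcases List.mem_cons.1 hb with hb | hb
      · exact G.acyclic a (Relation.TransGen.single (by have := b.2; rw [hb] at this; exact this))
      · exact hl.1 _ hb b.2
    rw [this]
    congr 1
    funext t
    refine ih hl.2 _ _ fun b hb => ?_
    by_cases hba : b = a
    · subst hba; simp
    · simp [hba, h b (by simp [hba, hb])]

/-- The interventional distribution only depends on the values of the intervened nodes. -/
theorem doDist_congr [Finite N] (M : CBN G X) (S : Set N) (z z' : ∀ a, X a)
    (h : ∀ a ∈ S, z a = z' a) : M.doDist S z = M.doDist S z' := by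
  refine M.run_congr _ ?_ _ _ ?_
  · exact (G.exists_topological_order.choose_spec.2.2).filter _
  · intro a ha
    refine h a ?_
    by_contra hS
    exact ha (List.mem_filter.2 ⟨G.exists_topological_order.choose_spec.2.1 a, by simpa using hS⟩)

end CBN

/-! ### Factorizations over a mixed graph -/

/-- The ingredients of a product `p(U) ∏_C p(C | pa(C), U_C)` over the ADMG `H` with domains
`Z C`: finitely many independent latent variables `i : ι` with domains `Y i` and laws `law i`,
and for each node `C` a set `lat C` of latent variables (this is `U_C`) and a Markov kernel
`p(C | pa(C), U_C)`. -/
structure ADMG.LatentModel {W : Type u} (H : ADMG W) (Z : W → Type x)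
    [∀ C, MeasurableSpace (Z C)] where
  ι : Type v
  [fin : Fintype ι]
  Y : ι → Type w
  [meas : ∀ i, MeasurableSpace (Y i)]
  law : ∀ i, Measure (Y i)
  [prob : ∀ i, IsProbabilityMeasure (law i)]
  lat : W → Set ι
  mech : ∀ C, Kernel ((∀ D : H.pa C, Z D) × (∀ i : lat C, Y i)) (Z C)
  [markov : ∀ C, IsMarkovKernel (mech C)]

namespace ADMG.LatentModel

attribute [instance] fin meas prob markov

variable {W : Type*} {H : ADMG W} {Z : W → Type*} [∀ C, MeasurableSpace (Z C)]

/-- The joint law `p(U)` of the latent variables: they are independent. -/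
noncomputable def latentLaw (F : H.LatentModel Z) : Measure (∀ i, F.Y i) := Measure.pi F.law

/-- For a fixed value `y` of the latent variables, the kernels `p(C | pa(C), U_C = y_C)`. -/
noncomputable def atLatent (F : H.LatentModel Z) (y : ∀ i, F.Y i) : CBN H.toDAG Z where
  mech C := (F.mech C).comap (fun z => (z, fun i : F.lat C => y i)) (by fun_prop)
  markov _ := inferInstance

end ADMG.LatentModel

/-! Every low-level node has at most one owner among the nodes of the abstracted DAG. Merging unites
the owners. Deleting a node with one child hands everything it owns to that child, and whatever a
deleted childless node owns becomes irrelevant. The invariant `ClusterGraph.IsOwner` says that a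
node with an edge to a node of another owner must be a true member of its own cluster. Hence the
nodes that a cluster `C` has absorbed act on other clusters only through the members of `C`: they
can be sampled inside the kernel of `C`, and fixing the members of `C` cuts off all their influence.

The nodes owned by an exogenous node of the abstracted DAG form a block that is closed under
parents, so different blocks are independent. These blocks, together with the exogenous nodes that
they do not absorb, are the variables `U_i`.

The DAG that carries the network need not be the DAG that was abstracted; the two only share the
latent projection `L`. Ownership of endogenous nodes is therefore described by the directed and
bidirected edges of `L` alone (`IsADMGAbstraction.exists_owner`), and the exogenous nodes are then
assigned anew (`IsADMGAbstraction.exists_clusterRoles`).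

Once the roles are known, nodes outside a parent-closed set can be dropped
(`CBN.lintegral_run_filter`) and the others sampled in any topological order (`CBN.run_eq_of_perm`).
Sampling all blocks, then the clusters in an order of `H`, gives the factorization
(`ClusterRoles.lintegral_doDist`). -/

open scoped ENNReal

/-! ### Sequential sampling: locality, marginals and change of order -/

namespace CBN

variable {N : Type u} {G : DAG N} {X : N → Type x} [∀ a, MeasurableSpace (X a)]

theorem run_append (M : CBN G X) (l l' : List N) : M.run (l ++ l') = M.run l' ∘ₖ M.run l := by
  induction l with
  | nil => exact (Kernel.comp_id _).symm
  | cons a l ih => rw [List.cons_append, run, run, ih, Kernel.comp_assoc]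

theorem lintegral_run_append (M : CBN G X) (l l' : List N) (z : ∀ a, X a)
    {f : (∀ a, X a) → ℝ≥0∞} (hf : Measurable f) :
    ∫⁻ t, f t ∂M.run (l ++ l') z = ∫⁻ s, ∫⁻ t, f t ∂M.run l' s ∂M.run l z := by
  rw [run_append, Kernel.lintegral_comp _ _ _ hf]

theorem lintegral_run_nil (M : CBN G X) (z : ∀ a, X a)
    {f : (∀ a, X a) → ℝ≥0∞} (hf : Measurable f) : ∫⁻ t, f t ∂M.run [] z = f z := by
  rw [run, Kernel.id_apply, lintegral_dirac' _ hf]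

theorem lintegral_run_cons [DecidableEq N] (M : CBN G X) (a : N) (l : List N) (z : ∀ a, X a)
    {f : (∀ a, X a) → ℝ≥0∞} (hf : Measurable f) :
    ∫⁻ t, f t ∂M.run (a :: l) z =
      ∫⁻ s, ∫⁻ t, f t ∂M.run l (Function.update z a s) ∂M.mech a (fun b => z b) := by
  rw [run_cons, Measure.lintegral_bind _ hf.aemeasurable]
  exact ((M.run l).measurable.comp (measurable_update z)).aemeasurable

/-- Running through `l` from `z` only reaches states that agree with `z` outside `l`. -/
theorem lintegral_run_congr (M : CBN G X) (l : List N) (z : ∀ a, X a)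
    {f g : (∀ a, X a) → ℝ≥0∞} (hf : Measurable f) (hg : Measurable g)
    (h : ∀ t, (∀ a, a ∉ l → t a = z a) → f t = g t) :
    ∫⁻ t, f t ∂M.run l z = ∫⁻ t, g t ∂M.run l z := by
  classical
  induction l generalizing z with
  | nil =>
    rw [lintegral_run_nil _ _ hf, lintegral_run_nil _ _ hg]
    exact h z fun _ _ => rfl
  | cons a l ih =>
    rw [lintegral_run_cons _ _ _ _ hf, lintegral_run_cons _ _ _ _ hg]
    refine lintegral_congr fun s => ih _ fun t ht => h t fun b hb => ?_
    rw [List.mem_cons, not_or] at hb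
    rw [ht b hb.2, Function.update_of_ne hb.1]

/-- Let `p` be a set of nodes that contains the parents of its sampled members. The marginal on
`p` does not change if only the members of `p` are sampled. -/
theorem lintegral_run_filter (M : CBN G X) (p : N → Prop) [DecidablePred p] (l : List N)
    (hl : l.Pairwise fun a b => ¬ G.Adj b a)
    (hp : ∀ a b, b ∈ l → p b → G.Adj a b → p a) (z z' : ∀ a, X a)
    (hz : ∀ a, p a → a ∉ l → z a = z' a)
    {f : (∀ a, X a) → ℝ≥0∞} (hf : Measurable f)
    (hfp : ∀ s t, (∀ a, p a → s a = t a) → f s = f t) :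
    ∫⁻ t, f t ∂M.run l z = ∫⁻ t, f t ∂M.run (l.filter fun a => p a) z' := by
  classical
  induction l generalizing z z' with
  | nil =>
    rw [List.filter_nil, lintegral_run_nil _ _ hf, lintegral_run_nil _ _ hf]
    exact hfp _ _ fun a ha => hz a ha (by simp)
  | cons a l ih =>
    rw [List.pairwise_cons] at hl
    have ih' := ih hl.2 fun c b hb => hp c b (List.mem_cons_of_mem _ hb)
    by_cases ha : p a
    · rw [List.filter_cons_of_pos (by simpa using ha), lintegral_run_cons _ _ _ _ hf,
        lintegral_run_cons _ _ _ _ hf]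
      have : (fun b : G.pa a => z b) = fun b : G.pa a => z' b := by
        funext b
        refine hz _ (hp _ _ List.mem_cons_self ha b.2) fun hb => ?_
        rcases List.mem_cons.1 hb with hb | hb
        · exact G.acyclic a (.single (by have := b.2; rw [hb] at this; exact this))
        · exact hl.1 _ hb b.2
      rw [this]
      refine lintegral_congr fun s => ih' _ _ fun b hb hbl => ?_
      by_cases hba : b = a
      · subst hba; simp
      · simp [hba, hz b hb (by simp [hba, hbl])]
    · have := M.markov a
      rw [List.filter_cons_of_neg (by simpa using ha), lintegral_run_cons _ _ _ _ hf]
      -- The value drawn for `a` is invisible on `p`, so the inner integral is constant in `s`, and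
      -- the Markov kernel has total mass one.
      rw [lintegral_congr fun s => ih' (Function.update z a s) z' fun b hb hbl => ?_]
      · simp
      · have hba : b ≠ a := fun h => ha (h ▸ hb)
        rw [Function.update_of_ne hba]
        exact hz b hb (by simp [hba, hbl])

/-- The values that are sampled in `l` only depend on the values of the parents of `l`. -/
theorem lintegral_run_congr_start (M : CBN G X) (p : N → Prop) (l : List N)
    (hl : l.Pairwise fun a b => ¬ G.Adj b a) (hlp : ∀ a ∈ l, p a)
    (hp : ∀ a b, b ∈ l → G.Adj a b → p a) (z z' : ∀ a, X a)
    (hz : ∀ a, p a → a ∉ l → z a = z' a)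
    {f : (∀ a, X a) → ℝ≥0∞} (hf : Measurable f)
    (hfp : ∀ s t, (∀ a, p a → s a = t a) → f s = f t) :
    ∫⁻ t, f t ∂M.run l z = ∫⁻ t, f t ∂M.run l z' := by
  classical
  rw [M.lintegral_run_filter p l hl (fun a b hb _ => hp a b hb) z z' hz hf hfp,
    List.filter_eq_self.2 fun a ha => by simpa using hlp a ha]

/-- Neither node reads the value of the other, so Tonelli's theorem exchanges the two integrals, and
the two updates commute. -/
theorem run_swap (M : CBN G X) (a b : N) (l : List N) (hne : a ≠ b) (hab : ¬ G.Adj a b)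
    (hba : ¬ G.Adj b a) : M.run (a :: b :: l) = M.run (b :: a :: l) := by
  classical
  have := M.markov
  ext z : 1
  refine Measure.ext_of_lintegral _ fun f hf => ?_
  simp_rw [lintegral_run_cons _ _ _ _ hf]
  have key : ∀ c d : N, c ≠ d → ¬ G.Adj c d → ∀ s : X c,
      (fun e : G.pa d => Function.update z c s e) = fun e : G.pa d => z e := by
    intro c d _ hcd s
    funext e
    exact Function.update_of_ne (fun h => hcd (by have := e.2; rw [h] at this; exact this)) _ _
  simp_rw [key a b hne hab, key b a hne.symm hba]
  rw [lintegral_lintegral_swap]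
  · refine lintegral_congr fun s => lintegral_congr fun t => ?_
    rw [Function.update_comm hne]
  · refine (Measurable.lintegral_kernel hf).comp ?_ |>.aemeasurable
    refine measurable_pi_lambda _ fun c => ?_
    by_cases hcb : c = b
    · subst hcb; simpa using measurable_snd
    · by_cases hca : c = a
      · subst hca; simpa [Function.update_of_ne hcb] using measurable_fst
      · simp [Function.update_of_ne hcb, Function.update_of_ne hca]

theorem run_move_front (M : CBN G X) (a : N) (l l' : List N)
    (h : ∀ b ∈ l, a ≠ b ∧ ¬ G.Adj a b ∧ ¬ G.Adj b a) :
    M.run (l ++ a :: l') = M.run (a :: (l ++ l')) := by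
  induction l with
  | nil => rfl
  | cons b l ih =>
    obtain ⟨h1, h2, h3⟩ := h b List.mem_cons_self
    rw [List.cons_append, List.cons_append, run_swap M a b _ h1 h2 h3, run, ih, ← run]
    exact fun c hc => h c (List.mem_cons_of_mem _ hc)

/-- Sampling in topological order does not depend on the order. -/
theorem run_eq_of_perm (M : CBN G X) {l l' : List N} (hperm : l.Perm l') (hnd : l.Nodup)
    (hl : l.Pairwise fun a b => ¬ G.Adj b a) (hl' : l'.Pairwise fun a b => ¬ G.Adj b a) :
    M.run l = M.run l' := by
  induction l' generalizing l with
  | nil => rw [hperm.eq_nil]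
  | cons a l' ih =>
    obtain ⟨l₁, l₂, rfl⟩ := List.append_of_mem (hperm.mem_iff.2 List.mem_cons_self)
    have hp : (l₁ ++ l₂).Perm l' := (List.perm_middle.symm.trans hperm).cons_inv
    have hsub : (l₁ ++ l₂).Sublist (l₁ ++ a :: l₂) :=
      (List.Sublist.refl _).append (List.sublist_cons_self _ _)
    rw [List.pairwise_cons] at hl'
    -- A node `b` of `l₁` precedes `a` in one order and follows it in the other, which excludes
    -- edges in both directions.
    rw [run_move_front, run, ih hp (hnd.sublist hsub) (hl.sublist hsub) hl'.2, run]
    intro b hb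
    refine ⟨?_, ?_, ?_⟩
    · rintro rfl
      exact (List.nodup_append.1 hnd).2.2 _ hb _ List.mem_cons_self rfl
    · exact (List.pairwise_append.1 hl).2.2 b hb a List.mem_cons_self
    · exact hl'.1 b (hp.mem_iff.1 (List.mem_append_left _ hb))

/-- Every domain of a causal Bayesian network is nonempty. -/
theorem nonempty_states [Finite N] (M : CBN G X) : Nonempty (∀ a, X a) := by
  classical
  have := M.markov
  -- Induction on initial segments of the order: once the parents have values, the kernel gives a
  -- probability measure on `X a`, which forces `X a` to be nonempty.
  have h : ∀ l l' : List N, l ++ l' = G.order → ∀ a ∈ l, Nonempty (X a) := by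
    intro l
    induction l using List.reverseRecOn with
    | nil => simp
    | append_singleton l b ih =>
      intro l' hl a ha
      have ih' := ih (b :: l') (by simpa using hl)
      rcases List.mem_append.1 ha with ha | ha
      · exact ih' a ha
      · obtain rfl := List.mem_singleton.1 ha
        have hs := G.exists_topological_order.choose_spec
        change G.order.Nodup ∧ (∀ a, a ∈ G.order) ∧ _ at hs
        have hpa : ∀ c : G.pa a, Nonempty (X c) := by
          rintro ⟨c, hc⟩
          refine ih' c ?_
          have hm := hs.2.1 c
          have ht : G.order.Pairwise _ := hs.2.2
          rw [← hl] at hm ht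
          rw [List.append_assoc, List.pairwise_append] at ht
          rw [List.append_assoc, List.mem_append] at hm
          rcases hm with hm | hm
          · exact hm
          · rcases List.mem_cons.1 hm with rfl | hm
            · exact absurd (Relation.TransGen.single hc) (G.acyclic c)
            · exact absurd hc ((List.pairwise_cons.1 ht.2.1).1 c hm)
        exact (M.mech a fun c => (hpa c).some).nonempty_of_neZero
  exact ⟨fun a => (h G.order [] (by simp) a
    (G.exists_topological_order.choose_spec.2.1 a)).some⟩

end CBN

theorem DAG.nodup_order {N : Type u} [Finite N] (G : DAG N) : G.order.Nodup :=
  G.exists_topological_order.choose_spec.1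

theorem DAG.mem_order {N : Type u} [Finite N] (G : DAG N) (a : N) : a ∈ G.order :=
  G.exists_topological_order.choose_spec.2.1 a

theorem DAG.pairwise_order {N : Type u} [Finite N] (G : DAG N) :
    G.order.Pairwise fun a b => ¬ G.Adj b a :=
  G.exists_topological_order.choose_spec.2.2

/-! ### Roles of the low-level nodes: latent blocks and clusters -/

/-- An assignment of the nodes of `G` to independent blocks `i : ι` of latent variables and to the
clusters of `H`; the remaining nodes are irrelevant for the clusters. -/
structure ClusterRoles {V : Type u} {U : Type v} {W : Type w} (G : DAG (V ⊕ U)) (H : ADMG W)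
    (cl : W → Set V) (ι : Type*) where
  role : V ⊕ U → Option (ι ⊕ W)
  lat : W → Set ι
  role_of_mem : ∀ C, ∀ a ∈ cl C, role (Sum.inl a) = some (Sum.inr C)
  latent_of_adj : ∀ a b i, role b = some (Sum.inl i) → G.Adj a b → role a = some (Sum.inl i)
  mem_lat : ∀ a b i C, role a = some (Sum.inl i) → role b = some (Sum.inr C) → G.Adj a b →
    i ∈ lat C
  -- The membership clause is what lets an intervention on the members of `C` screen off everything
  -- else assigned to `C`.
  mem_or_adj : ∀ a b C D, role a = some (Sum.inr C) → role b = some (Sum.inr D) → G.Adj a b →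
    C = D ∨ (a ∈ Sum.inl '' cl C ∧ H.Adj C D)
  none_of_adj : ∀ a b, role a = none → G.Adj a b → role b = none

namespace ClusterRoles

variable {V : Type u} {U : Type v} {W : Type w} {G : DAG (V ⊕ U)} {H : ADMG W}
  {cl : W → Set V} {ι : Type*} (R : ClusterRoles G H cl ι)
  {X : V ⊕ U → Type x}

/-- The values of the block `i` of latent variables. -/
def latentState (z : ∀ a, X a) (i : ι) (a : {a // R.role a = some (Sum.inl i)}) : X a := z a

/-- The values of the clusters. -/
def clusterState (cl : W → Set V) (z : ∀ a, X a) (C : W) (a : cl C) : X (Sum.inl a) := z (Sum.inl a)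

open Classical in
/-- A state in which the latent variables have prescribed values. -/
noncomputable def withLatent (z : ∀ a, X a)
    (y : ∀ i, ∀ a : {a // R.role a = some (Sum.inl i)}, X a) (a : V ⊕ U) : X a :=
  if h : ∃ i, R.role a = some (Sum.inl i) then y h.choose ⟨a, h.choose_spec⟩ else z a

theorem withLatent_of_role (z : ∀ a, X a)
    (y : ∀ i, ∀ a : {a // R.role a = some (Sum.inl i)}, X a) (a : V ⊕ U) (i : ι)
    (h : R.role a = some (Sum.inl i)) : R.withLatent z y a = y i ⟨a, h⟩ := by
  have hex : ∃ i, R.role a = some (Sum.inl i) := ⟨i, h⟩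
  have hi : hex.choose = i := Sum.inl_injective (Option.some.inj (hex.choose_spec.symm.trans h))
  rw [withLatent, dif_pos hex]
  -- The type of `y j` depends on `j`, so the chosen index is generalized before it is identified
  -- with `i`.
  have key : ∀ j (hj : R.role a = some (Sum.inl j)), j = i → y j ⟨a, hj⟩ = y i ⟨a, h⟩ := by
    rintro j hj rfl
    rfl
  exact key _ _ hi

theorem latentState_withLatent (z : ∀ a, X a)
    (y : ∀ i, ∀ a : {a // R.role a = some (Sum.inl i)}, X a) :
    R.latentState (R.withLatent z y) = y := by
  funext i a
  exact R.withLatent_of_role z y a i a.2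

theorem clusterState_withLatent (z : ∀ a, X a)
    (y : ∀ i, ∀ a : {a // R.role a = some (Sum.inl i)}, X a) :
    clusterState cl (R.withLatent z y) = clusterState cl z := by
  funext C a
  have := R.role_of_mem C a a.2
  refine dif_neg ?_
  rintro ⟨i, hi⟩
  simp [this] at hi

open Classical in
/-- A state in which the parents of the cluster `C` and its latent variables have prescribed
values. -/
noncomputable def parentState (z : ∀ a, X a) (C : W)
    (q : (∀ D : H.pa C, ∀ a : cl D, X (Sum.inl a)) ×
      (∀ i : R.lat C, ∀ a : {a // R.role a = some (Sum.inl (i : ι))}, X a)) : ∀ a, X a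
  | Sum.inl a =>
    if h : ∃ i : R.lat C, R.role (Sum.inl a) = some (Sum.inl (i : ι)) then
      q.2 h.choose ⟨_, h.choose_spec⟩
    else if h : ∃ D : H.pa C, a ∈ cl D then q.1 h.choose ⟨a, h.choose_spec⟩ else z (Sum.inl a)
  | Sum.inr a =>
    if h : ∃ i : R.lat C, R.role (Sum.inr a) = some (Sum.inl (i : ι)) then
      q.2 h.choose ⟨_, h.choose_spec⟩
    else z (Sum.inr a)

/-- Whichever index is chosen in `parentState`, the prescribed value comes from the same state `x`.
-/
theorem parentState_of_latent (z x : ∀ a, X a) (C : W) (a : V ⊕ U) (i : ι) (hi : i ∈ R.lat C)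
    (ha : R.role a = some (Sum.inl i)) :
    R.parentState z C (fun D => clusterState cl x D, fun i => R.latentState x i) a = x a := by
  have hex : ∃ i : R.lat C, R.role a = some (Sum.inl (i : ι)) := ⟨⟨i, hi⟩, ha⟩
  rcases a with a | a <;> simp only [parentState, dif_pos hex, latentState]

theorem parentState_of_mem (z x : ∀ a, X a) (C D : W) (a : V) (hD : H.Adj D C) (ha : a ∈ cl D) :
    R.parentState z C (fun D => clusterState cl x D, fun i => R.latentState x i) (Sum.inl a) =
      x (Sum.inl a) := by
  have hex : ∃ D : H.pa C, a ∈ cl D := ⟨⟨D, hD⟩, ha⟩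
  have hn : ¬ ∃ i : R.lat C, R.role (Sum.inl a) = some (Sum.inl (i : ι)) := by
    rintro ⟨i, hi⟩
    simp [R.role_of_mem D a ha] at hi
  simp only [parentState, dif_neg hn, dif_pos hex, clusterState]

section nodesOf

variable [Finite V] [Finite U]

open Classical in
/-- The nodes of role `r` in topological order. -/
noncomputable def nodesOf (r : ι ⊕ W) : List (V ⊕ U) := G.order.filter fun a => R.role a = some r

theorem mem_nodesOf (r : ι ⊕ W) (a : V ⊕ U) : a ∈ R.nodesOf r ↔ R.role a = some r := by
  simp [nodesOf, G.mem_order]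

theorem pairwise_nodesOf (r : ι ⊕ W) : (R.nodesOf r).Pairwise fun a b => ¬ G.Adj b a :=
  G.pairwise_order.filter _

theorem nodup_nodesOf (r : ι ⊕ W) : (R.nodesOf r).Nodup := G.nodup_order.filter _

theorem pairwise_flatMap_nodesOf (l : List (ι ⊕ W))
    (hl : l.Pairwise fun r s => ∀ a b, R.role a = some r → R.role b = some s → ¬ G.Adj b a) :
    (l.flatMap R.nodesOf).Pairwise fun a b => ¬ G.Adj b a := by
  rw [List.pairwise_flatMap]
  refine ⟨fun r _ => R.pairwise_nodesOf r, hl.imp fun h a ha b hb => ?_⟩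
  exact h a b ((R.mem_nodesOf _ _).1 ha) ((R.mem_nodesOf _ _).1 hb)

theorem nodup_flatMap_nodesOf (l : List (ι ⊕ W)) (hl : l.Nodup) :
    (l.flatMap R.nodesOf).Nodup := by
  rw [List.nodup_flatMap]
  refine ⟨fun r _ => R.nodup_nodesOf r, hl.imp fun h a ha hb => h ?_⟩
  rw [mem_nodesOf] at ha hb
  exact Option.some.inj (ha.symm.trans hb)

end nodesOf

variable [∀ a, MeasurableSpace (X a)]

@[fun_prop]
theorem measurable_latentState : Measurable (R.latentState (X := X)) :=
  measurable_pi_lambda _ fun _ => measurable_pi_lambda _ fun a => measurable_pi_apply (a : V ⊕ U)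

@[fun_prop]
theorem measurable_clusterState : Measurable (clusterState (X := X) cl) :=
  measurable_pi_lambda _ fun _ => measurable_pi_lambda _ fun a =>
    measurable_pi_apply (Sum.inl (a : V) : V ⊕ U)

theorem measurable_withLatent (z : ∀ a, X a) : Measurable (R.withLatent z) := by
  refine measurable_pi_lambda _ fun a => ?_
  by_cases h : ∃ i, R.role a = some (Sum.inl i)
  · simp only [withLatent, dif_pos h]
    exact (measurable_pi_apply _).comp (measurable_pi_apply _)
  · simp only [withLatent, dif_neg h]
    exact measurable_const

theorem measurable_parentState (z : ∀ a, X a) (C : W) : Measurable (R.parentState z C) := by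
  refine measurable_pi_lambda _ fun a => ?_
  rcases a with a | a
  · by_cases h : ∃ i : R.lat C, R.role (Sum.inl a) = some (Sum.inl (i : ι))
    · simp only [parentState, dif_pos h]
      exact (measurable_pi_apply _).comp ((measurable_pi_apply _).comp measurable_snd)
    · by_cases h' : ∃ D : H.pa C, a ∈ cl D
      · simp only [parentState, dif_neg h, dif_pos h']
        exact (measurable_pi_apply _).comp ((measurable_pi_apply _).comp measurable_fst)
      · simp only [parentState, dif_neg h, dif_neg h']
        exact measurable_const
  · by_cases h : ∃ i : R.lat C, R.role (Sum.inr a) = some (Sum.inl (i : ι))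
    · simp only [parentState, dif_pos h]
      exact (measurable_pi_apply _).comp ((measurable_pi_apply _).comp measurable_snd)
    · simp only [parentState, dif_neg h]
      exact measurable_const

/-! ### The latent model and the truncated factorization -/

variable [Finite V] [Finite U]

/-- The joint law of the block `i` of latent variables. -/
noncomputable def blockLaw (M : CBN G X) (z : ∀ a, X a) (i : ι) :
    Measure (∀ a : {a // R.role a = some (Sum.inl i)}, X a) :=
  (M.run (R.nodesOf (Sum.inl i)) z).map fun t => R.latentState t i

instance isProbabilityMeasure_blockLaw (M : CBN G X) (z : ∀ a, X a) (i : ι) :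
    IsProbabilityMeasure (R.blockLaw M z i) :=
  Measure.isProbabilityMeasure_map
    ((measurable_pi_apply i).comp R.measurable_latentState).aemeasurable

/-- The latent variables are the blocks, and each cluster is sampled along with the other nodes
that are assigned to it. -/
noncomputable def latentModel [Fintype ι] (M : CBN G X) (z : ∀ a, X a) :
    H.LatentModel (fun C => ∀ a : cl C, X (Sum.inl a)) where
  ι := ι
  Y i := ∀ a : {a // R.role a = some (Sum.inl i)}, X a
  law := R.blockLaw M z
  lat := R.lat
  mech C := ((M.run (R.nodesOf (Sum.inr C))).comap (R.parentState z C)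
    (R.measurable_parentState z C)).map fun t => clusterState cl t C
  markov C := Kernel.IsMarkovKernel.map _ ((measurable_pi_apply C).comp measurable_clusterState)

/-- The causal Bayesian network over the clusters for fixed values of the latent variables. -/
noncomputable def clusterCBN [Fintype ι] (M : CBN G X) (z : ∀ a, X a)
    (y : ∀ i, ∀ a : {a // R.role a = some (Sum.inl i)}, X a) :
    CBN H.toDAG (fun C => ∀ a : cl C, X (Sum.inl a)) :=
  (R.latentModel M z).atLatent y

variable (M : CBN G X) (z₀ : ∀ a, X a)

/-- A block is closed under parents, so its law does not depend on the starting state. -/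
theorem run_nodesOf_latent (i : ι) (x : ∀ a, X a)
    {s : Set (∀ a : {a // R.role a = some (Sum.inl i)}, X a)} (hs : MeasurableSet s) :
    M.run (R.nodesOf (Sum.inl i)) x {t | R.latentState t i ∈ s} =
      R.blockLaw M z₀ i s := by
  have hm : Measurable fun t : ∀ a, X a => R.latentState t i :=
    (measurable_pi_apply i).comp R.measurable_latentState
  rw [blockLaw, Measure.map_apply hm hs]
  have hms : MeasurableSet {t : ∀ a, X a | R.latentState t i ∈ s} := hm hs
  change _ = M.run (R.nodesOf (Sum.inl i)) z₀ {t | R.latentState t i ∈ s}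
  rw [← lintegral_indicator_one hms, ← lintegral_indicator_one hms]
  refine M.lintegral_run_congr_start (fun a => R.role a = some (Sum.inl i)) _
    (R.pairwise_nodesOf _) ?_ ?_ _ _ ?_ (measurable_one.indicator hms) ?_
  · exact fun a ha => (R.mem_nodesOf _ _).1 ha
  · exact fun a b hb hab => R.latent_of_adj a b i ((R.mem_nodesOf _ _).1 hb) hab
  · exact fun a ha ha' => absurd ((R.mem_nodesOf _ _).2 ha) ha'
  · intro t t' h
    have : R.latentState t i = R.latentState t' i := funext fun a => h a a.2
    by_cases h2 : R.latentState t' i ∈ s <;> simp [Set.indicator, this, h2]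

variable [Fintype ι]

/-- A parent of a node assigned to `C` is itself assigned to `C`, lies in a block of `lat C`, or is
a member of a parent cluster. `parentState` reproduces `x` in the last two cases, and in the first
the value is resampled. -/
theorem lintegral_mech_clusterCBN (C : W) (x : ∀ a, X a)
    {f : (∀ a : cl C, X (Sum.inl a)) → ℝ≥0∞} (hf : Measurable f) :
    ∫⁻ t, f t ∂(R.clusterCBN M z₀ (R.latentState x)).mech C
        (fun D => clusterState cl x D) =
      ∫⁻ t, f (clusterState cl t C) ∂M.run (R.nodesOf (Sum.inr C)) x := by
  have hm : Measurable fun t : ∀ a, X a => clusterState cl t C :=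
    (measurable_pi_apply C).comp measurable_clusterState
  change ∫⁻ t, f t ∂((((M.run (R.nodesOf (Sum.inr C))).comap (R.parentState z₀ C)
    (R.measurable_parentState z₀ C)).map fun t => clusterState cl t C)
      (fun D => clusterState cl x D, fun i => R.latentState x i)) = _
  rw [Kernel.map_apply _ hm, lintegral_map hf hm, Kernel.comap_apply]
  refine M.lintegral_run_congr_start
    (fun a => R.role a = some (Sum.inr C) ∨ ∃ b, R.role b = some (Sum.inr C) ∧ G.Adj a b) _
    (R.pairwise_nodesOf _) ?_ ?_ _ _ ?_ (hf.comp hm) ?_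
  · exact fun a ha => Or.inl ((R.mem_nodesOf _ _).1 ha)
  · exact fun a b hb hab => Or.inr ⟨b, (R.mem_nodesOf _ _).1 hb, hab⟩
  · intro a ha haC
    rw [mem_nodesOf] at haC
    obtain ⟨b, hb, hab⟩ := ha.resolve_left haC
    rcases hr : R.role a with _ | i | D
    · rw [R.none_of_adj a b hr hab] at hb
      simp at hb
    · exact R.parentState_of_latent _ _ _ _ i (R.mem_lat a b i C hr hb hab) hr
    · rcases R.mem_or_adj a b D C hr hb hab with rfl | ⟨⟨a, haD, rfl⟩, hD⟩
      · exact absurd hr haC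
      · exact R.parentState_of_mem _ _ _ D a hD haD
  · intro s t hst
    congr 1
    funext a
    exact hst _ (Or.inl (R.role_of_mem C a a.2))

/-- Sampling the clusters of a list in `G` amounts to sampling them in the latent model. -/
theorem lintegral_run_clusters (l : List W) (hl : l.Nodup) (x : ∀ a, X a)
    {f : (∀ C, ∀ a : cl C, X (Sum.inl a)) → ℝ≥0∞} (hf : Measurable f) :
    ∫⁻ t, f (clusterState cl t) ∂M.run (l.flatMap fun C => R.nodesOf (Sum.inr C)) x =
      ∫⁻ t, f t ∂(R.clusterCBN M z₀ (R.latentState x)).run l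
        (clusterState cl x) := by
  classical
  induction l generalizing x with
  | nil =>
    have hfm : Measurable fun t : ∀ a, X a => f (clusterState cl t) :=
      hf.comp measurable_clusterState
    rw [List.flatMap_nil, CBN.lintegral_run_nil _ _ hfm, CBN.lintegral_run_nil _ _ hf]
  | cons C l ih =>
    rw [List.nodup_cons] at hl
    have hfm : Measurable fun t : ∀ a, X a => f (clusterState cl t) :=
      hf.comp measurable_clusterState
    have hg : Measurable fun s : ∀ a : cl C, X (Sum.inl a) =>
        ∫⁻ t, f t ∂(R.clusterCBN M z₀ (R.latentState x)).run l
          (Function.update (clusterState cl x) C s) :=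
      (Measurable.lintegral_kernel hf).comp (measurable_update _)
    rw [List.flatMap_cons, CBN.lintegral_run_append _ _ _ _ hfm,
      CBN.lintegral_run_cons _ _ _ _ hf, R.lintegral_mech_clusterCBN M z₀ C x hg]
    refine M.lintegral_run_congr _ _ (Measurable.lintegral_kernel hfm) (hg.comp
      ((measurable_pi_apply C).comp measurable_clusterState)) fun t ht => ?_
    have h1 : R.latentState t = R.latentState x := by
      funext i a
      refine ht _ fun ha => ?_
      rw [mem_nodesOf, a.2] at ha
      simp at ha
    have h2 : clusterState cl t = Function.update (clusterState cl x) C (clusterState cl t C) := by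
      funext D
      by_cases hD : D = C
      · subst hD; simp
      · rw [Function.update_of_ne hD]
        funext a
        refine ht _ fun ha => hD ?_
        rw [mem_nodesOf, R.role_of_mem D a a.2] at ha
        simpa using ha
    rw [ih hl.2, h1, ← h2]

/-- Sampling the later blocks leaves block `i` unchanged, and their law ignores its value, so the
probability of a rectangle factors. -/
theorem run_latents (l : List ι) (hl : l.Nodup) (x : ∀ a, X a)
    (s : ∀ i, Set (∀ a : {a // R.role a = some (Sum.inl i)}, X a))
    (hs : ∀ i, MeasurableSet (s i)) :
    M.run (l.flatMap fun i => R.nodesOf (Sum.inl i)) x {t | ∀ i ∈ l, R.latentState t i ∈ s i} =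
      (l.map fun i => R.blockLaw M z₀ i (s i)).prod := by
  classical
  have hm : ∀ i, Measurable fun t : ∀ a, X a => R.latentState t i := fun i =>
    (measurable_pi_apply i).comp R.measurable_latentState
  have hms : ∀ l : List ι, MeasurableSet {t : ∀ a, X a | ∀ i ∈ l, R.latentState t i ∈ s i} := by
    intro l
    have : {t : ∀ a, X a | ∀ i ∈ l, R.latentState t i ∈ s i} =
        ⋂ i ∈ l, {t | R.latentState t i ∈ s i} := by ext; simp
    rw [this]
    exact MeasurableSet.biInter l.finite_toSet.countable fun i _ => hm i (hs i)
  induction l generalizing x with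
  | nil => simp
  | cons i l ih =>
    rw [List.nodup_cons] at hl
    have hi : MeasurableSet {t : ∀ a, X a | R.latentState t i ∈ s i} := hm i (hs i)
    have hind : ∀ l : List ι, Measurable
        ({t : ∀ a, X a | ∀ i ∈ l, R.latentState t i ∈ s i}.indicator (1 : (∀ a, X a) → ℝ≥0∞)) :=
      fun l => measurable_one.indicator (hms l)
    rw [List.flatMap_cons, ← lintegral_indicator_one (hms _),
      CBN.lintegral_run_append _ _ _ _ (hind _), List.map_cons, List.prod_cons,
      ← R.run_nodesOf_latent M z₀ i x (hs i), ← lintegral_indicator_one hi,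
      ← lintegral_mul_const _ (measurable_one.indicator hi)]
    refine lintegral_congr fun x' => ?_
    rw [← ih hl.2 x', ← lintegral_indicator_one (hms l), ← lintegral_const_mul _ (hind l)]
    refine M.lintegral_run_congr _ _ (hind _) ((hind l).const_mul _) fun t ht => ?_
    have h1 : R.latentState t i = R.latentState x' i := by
      funext a
      refine ht _ fun ha => ?_
      obtain ⟨j, hj, ha⟩ := List.mem_flatMap.1 ha
      rw [mem_nodesOf, a.2] at ha
      have : i = j := by simpa using ha
      exact hl.1 (this ▸ hj)
    by_cases h2 : R.latentState x' i ∈ s i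
    · simp [Set.indicator, h1, h2]
    · simp [Set.indicator, h1, h2]

/-- The blocks of latent variables are independent. -/
theorem map_latentState_run (l : List ι) (hl : l.Nodup) (hmem : ∀ i, i ∈ l) (x : ∀ a, X a) :
    (M.run (l.flatMap fun i => R.nodesOf (Sum.inl i)) x).map R.latentState =
      (R.latentModel M z₀).latentLaw := by
  classical
  change _ = Measure.pi (R.blockLaw M z₀)
  symm
  refine Measure.pi_eq fun s hs => ?_
  rw [Measure.map_apply R.measurable_latentState (MeasurableSet.univ_pi hs)]
  have h := R.run_latents M z₀ l hl x s hs
  rw [← List.prod_toFinset _ hl, show l.toFinset = Finset.univ by ext; simp [hmem]] at h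
  rw [← h]
  congr 1
  ext t
  simp [hmem]

/-- Measurability in `y` is inherited from a kernel of `M` by encoding `y` in a low-level state with
`withLatent`. -/
theorem measurable_lintegral_clusterCBN (l : List W) (hl : l.Nodup) (z : ∀ a, X a)
    {f : (∀ C, ∀ a : cl C, X (Sum.inl a)) → ℝ≥0∞} (hf : Measurable f) :
    Measurable fun y => ∫⁻ t, f t ∂(R.clusterCBN M z₀ y).run l (clusterState cl z) := by
  have h : ∀ y, ∫⁻ t, f t ∂(R.clusterCBN M z₀ y).run l (clusterState cl z) =
      ∫⁻ t, f (clusterState cl t) ∂M.run (l.flatMap fun C => R.nodesOf (Sum.inr C))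
        (R.withLatent z y) := by
    intro y
    rw [R.lintegral_run_clusters M z₀ l hl _ hf, latentState_withLatent, clusterState_withLatent]
  simp_rw [h]
  exact (Measurable.lintegral_kernel (hf.comp measurable_clusterState)).comp
    (R.measurable_withLatent z)

theorem lintegral_run_latents_clusters (k : List ι) (hk : k.Nodup) (hmem : ∀ i, i ∈ k)
    (l : List W) (hl : l.Nodup) (z : ∀ a, X a)
    {f : (∀ C, ∀ a : cl C, X (Sum.inl a)) → ℝ≥0∞} (hf : Measurable f) :
    ∫⁻ t, f (clusterState cl t) ∂M.run ((k.flatMap fun i => R.nodesOf (Sum.inl i)) ++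
        l.flatMap fun C => R.nodesOf (Sum.inr C)) z =
      ∫⁻ y, ∫⁻ t, f t ∂(R.clusterCBN M z₀ y).run l (clusterState cl z)
        ∂(R.latentModel M z₀).latentLaw := by
  have hfm : Measurable fun t : ∀ a, X a => f (clusterState cl t) :=
    hf.comp measurable_clusterState
  have hg := R.measurable_lintegral_clusterCBN M z₀ l hl z hf
  rw [CBN.lintegral_run_append _ _ _ _ hfm, ← R.map_latentState_run M z₀ k hk hmem z]
  refine Eq.trans ?_ (lintegral_map hg R.measurable_latentState).symm
  refine M.lintegral_run_congr _ _ (Measurable.lintegral_kernel hfm)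
    (hg.comp R.measurable_latentState) fun t ht => ?_
  rw [R.lintegral_run_clusters M z₀ l hl _ hf]
  have : clusterState cl t = clusterState cl z := by
    funext C a
    refine ht _ fun ha => ?_
    obtain ⟨i, -, ha⟩ := List.mem_flatMap.1 ha
    rw [mem_nodesOf, R.role_of_mem C a a.2] at ha
    simp at ha
  rw [this]

variable [Finite W]

open Classical in
theorem lintegral_doDist (S : Set W) (z : ∀ a, X a)
    {f : (∀ C, ∀ a : cl C, X (Sum.inl a)) → ℝ≥0∞} (hf : Measurable f)
    (hfS : ∀ s t, (∀ C ∉ S, s C = t C) → f s = f t) :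
    ∫⁻ t, f (clusterState cl t) ∂M.doDist (⋃ C ∈ S, Sum.inl '' cl C) z =
      ∫⁻ y, ∫⁻ t, f t ∂(R.clusterCBN M z₀ y).doDist S (clusterState cl z)
        ∂(R.latentModel M z₀).latentLaw := by
  have hfm : Measurable fun t : ∀ a, X a => f (clusterState cl t) :=
    hf.comp measurable_clusterState
  set T : Set (V ⊕ U) := ⋃ C ∈ S, Sum.inl '' cl C with hT
  have memT : ∀ a, a ∈ T ↔ ∃ C ∈ S, a ∈ Sum.inl '' cl C := fun a => by simp [hT]
  have roleT : ∀ a ∈ T, ∃ C ∈ S, R.role a = some (Sum.inr C) := by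
    intro a ha
    obtain ⟨C, hC, a, haC, rfl⟩ := (memT a).1 ha
    exact ⟨C, hC, R.role_of_mem C a haC⟩
  -- Nodes that an intervened cluster has absorbed without containing them are still sampled, but
  -- they are left out here: no sampled node satisfying `p` has them as parents.
  let p : V ⊕ U → Prop := fun a => (∃ i, R.role a = some (Sum.inl i)) ∨
    (∃ C ∉ S, R.role a = some (Sum.inr C)) ∨ a ∈ T
  let k : List ι := Finset.univ.toList
  let l : List W := H.order.filter fun C => C ∉ S
  have hk : k.Nodup := Finset.nodup_toList _
  have hl : l.Nodup := H.nodup_order.filter _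
  have hmem : ∀ i, i ∈ k := fun i => by simp [k]
  have heq : (k.map Sum.inl ++ l.map Sum.inr).flatMap R.nodesOf =
      (k.flatMap fun i => R.nodesOf (Sum.inl i)) ++ l.flatMap fun C => R.nodesOf (Sum.inr C) := by
    rw [List.flatMap_append, List.flatMap_map, List.flatMap_map]
  have hperm : ((G.order.filter fun a => a ∉ T).filter fun a => p a).Perm
      ((k.map Sum.inl ++ l.map Sum.inr).flatMap R.nodesOf) := by
    refine (List.perm_ext_iff_of_nodup ((G.nodup_order.filter _).filter _)
      (R.nodup_flatMap_nodesOf _ ?_)).2 fun a => ?_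
    · refine List.nodup_append.2 ⟨hk.map Sum.inl_injective, hl.map Sum.inr_injective, ?_⟩
      simp
    · rw [heq]
      simp only [List.mem_filter, G.mem_order, H.mem_order, true_and, decide_eq_true_eq,
        List.mem_append, List.mem_flatMap, mem_nodesOf, k, l, Finset.mem_toList, Finset.mem_univ, p]
      constructor
      · rintro ⟨h1, h2 | h2 | h2⟩
        · exact Or.inl h2
        · exact Or.inr h2
        · exact absurd h2 h1
      · rintro (⟨i, hi⟩ | ⟨C, hC, ha⟩)
        · refine ⟨fun ha => ?_, Or.inl ⟨i, hi⟩⟩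
          obtain ⟨C, -, hC⟩ := roleT a ha
          simp [hi] at hC
        · refine ⟨fun haT => ?_, Or.inr (Or.inl ⟨C, hC, ha⟩)⟩
          obtain ⟨D, hD, haD⟩ := roleT a haT
          rw [ha] at haD
          obtain rfl : C = D := by simpa using haD
          exact hC hD
  -- Blocks first is admissible because blocks have no parents outside themselves; edges between
  -- different clusters follow `H`.
  have hpw : ((k.map Sum.inl ++ l.map Sum.inr).flatMap R.nodesOf).Pairwise
      fun a b => ¬ G.Adj b a := by
    refine R.pairwise_flatMap_nodesOf _ (List.pairwise_append.2 ⟨?_, ?_, ?_⟩)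
    · rw [List.pairwise_map]
      refine hk.imp fun {i j} hij a b ha hb hab => hij ?_
      have := R.latent_of_adj b a i ha hab
      rw [hb] at this
      simpa using this.symm
    · rw [List.pairwise_map]
      refine (H.nodup_order.and H.pairwise_order).filter _ |>.imp ?_
      rintro C D ⟨hCD, hadj⟩ a b ha hb hab
      rcases R.mem_or_adj b a D C hb ha hab with h | h
      · exact hCD h.symm
      · exact hadj h.2
    · simp only [List.mem_map]
      rintro _ ⟨i, -, rfl⟩ _ ⟨C, -, rfl⟩ a b ha hb hab
      have := R.latent_of_adj b a i ha hab
      simp [hb] at this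
  have hclosed : ∀ a b, b ∈ G.order.filter (fun a => a ∉ T) → p b → G.Adj a b → p a := by
    intro a b hbT hb hab
    have hbT : b ∉ T := by simpa [G.mem_order] using hbT
    rcases hb with ⟨i, hi⟩ | ⟨C, hC, hbC⟩ | hb
    · exact Or.inl ⟨i, R.latent_of_adj a b i hi hab⟩
    · rcases hr : R.role a with _ | i | D
      · rw [R.none_of_adj a b hr hab] at hbC
        simp at hbC
      · exact Or.inl ⟨i, hr⟩
      · by_cases hD : D ∈ S
        · rcases R.mem_or_adj a b D C hr hbC hab with rfl | h
          · exact absurd hD hC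
          · exact Or.inr (Or.inr ((memT a).2 ⟨D, hD, h.1⟩))
        · exact Or.inr (Or.inl ⟨D, hD, hr⟩)
    · exact absurd hb hbT
  rw [CBN.doDist, M.lintegral_run_filter p _ (G.pairwise_order.filter _) hclosed z z
      (fun _ _ _ => rfl) hfm ?_,
    M.run_eq_of_perm hperm ((G.nodup_order.filter _).filter _)
      ((G.pairwise_order.filter _).filter _) hpw, heq,
    R.lintegral_run_latents_clusters M z₀ k hk hmem l hl z hf]
  · rfl
  · intro s t hst
    refine hfS _ _ fun C hC => ?_
    funext a
    exact hst _ (Or.inr (Or.inl ⟨C, hC, R.role_of_mem C a a.2⟩))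

theorem doDist_map_apply (S : Set W) (z : ∀ a, X a)
    {E : Set (∀ C : (Sᶜ : Set W), ∀ a : cl C, X (Sum.inl a))} (hE : MeasurableSet E) :
    (M.doDist (⋃ C ∈ S, Sum.inl '' cl C) z).map
        (fun y (C : (Sᶜ : Set W)) (a : cl C) => y (Sum.inl a)) E =
      ∫⁻ y, (((R.latentModel M z₀).atLatent y).doDist S (fun C a => z (Sum.inl a))).map
        (fun t (C : (Sᶜ : Set W)) => t C) E ∂(R.latentModel M z₀).latentLaw := by
  have h1 : Measurable fun (t : ∀ C, ∀ a : cl C, X (Sum.inl a)) (C : (Sᶜ : Set W)) => t C := by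
    fun_prop
  have h2 : Measurable fun (t : ∀ a, X a) (C : (Sᶜ : Set W)) (a : cl C) => t (Sum.inl a) :=
    h1.comp (measurable_clusterState (X := X) (cl := cl))
  have hf : Measurable fun t : ∀ C, ∀ a : cl C, X (Sum.inl a) =>
      E.indicator
        (1 : (∀ C : (Sᶜ : Set W), ∀ a : cl C, X (Sum.inl a)) → ℝ≥0∞) (fun C : (Sᶜ : Set W) => t C) :=
    (measurable_one.indicator hE).comp h1
  have key := R.lintegral_doDist M z₀ S z hf fun s t hst => by
    congr 1
    funext C
    exact hst C C.2
  rw [← lintegral_indicator_one hE, lintegral_map (measurable_one.indicator hE) h2]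
  refine Eq.trans key (lintegral_congr fun y => ?_)
  rw [← lintegral_indicator_one hE, lintegral_map (measurable_one.indicator hE) h1]
  rfl

end ClusterRoles

/-! ### Owners in graphical abstractions -/

namespace ClusterGraph

variable {N : Type u}

/-- `K` results from `G` by assigning each node of `G` to the node of `K` that has absorbed it, if
any: only members of the cluster itself may have edges to other clusters. -/
structure IsOwner (G : DAG N) (K : ClusterGraph N) (own : N → Option (Set N)) : Prop where
  mem_nodes : ∀ a A, own a = some A → A ∈ K.nodes
  nonempty : ∀ A ∈ K.nodes, A.Nonempty
  of_mem : ∀ A ∈ K.nodes, ∀ a ∈ A, own a = some A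
  none_of_adj : ∀ a b, own a = none → G.Adj a b → own b = none
  adj_iff : ∀ A B, K.Adj A B ↔ A ≠ B ∧ ∃ a b, own a = some A ∧ own b = some B ∧ G.Adj a b
  eq_of_notMem : ∀ a b A B, own a = some A → a ∉ A → G.Adj a b → own b = some B → B = A

theorem IsOwner.ofDAG (G : DAG N) : IsOwner G (ofDAG G) fun a => some {a} where
  mem_nodes a A h := ⟨a, by simpa using h⟩
  nonempty := by rintro _ ⟨a, rfl⟩; exact ⟨a, rfl⟩
  of_mem := by rintro _ ⟨a, rfl⟩ b rfl; rfl
  none_of_adj := by simp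
  adj_iff A B := by
    constructor
    · rintro ⟨a, b, rfl, rfl, h⟩
      refine ⟨fun hab => ?_, a, b, rfl, rfl, h⟩
      rw [Set.singleton_eq_singleton_iff] at hab
      subst hab
      exact G.acyclic _ (.single h)
    · rintro ⟨-, a, b, ha, hb, h⟩
      exact ⟨a, b, (Option.some.inj ha).symm, (Option.some.inj hb).symm, h⟩
  eq_of_notMem := by
    intro a b A B ha haA
    rw [← Option.some.inj ha] at haA
    exact absurd rfl haA

/-- What `A` owned becomes ownerless. Since `A` has no child in `K`, such nodes have no edges to
nodes of a remaining owner. -/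
theorem IsOwner.delete_childless {G : DAG N} {K : ClusterGraph N} {own : N → Option (Set N)}
    (h : IsOwner G K own) {A : Set N} (hA : A ∈ K.nodes) (hch : ∀ B, ¬ K.Adj A B) :
    ∃ own', IsOwner G (K.delete A) own' := by
  classical
  have hne := h.nonempty A hA
  have key : ∀ a B, (if own a = some A then none else own a) = some B ↔
      own a = some B ∧ B ≠ A := by
    intro a B
    split_ifs with ha
    · rw [ha]; simp +contextual [eq_comm]
    · refine ⟨fun hB => ⟨hB, ?_⟩, fun hB => hB.1⟩
      rintro rfl; exact ha hB
  refine ⟨fun a => if own a = some A then none else own a, ?_⟩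
  constructor
  · intro a B hB
    rw [key] at hB
    exact ⟨h.mem_nodes _ _ hB.1, hB.2⟩
  · exact fun B hB => h.nonempty B hB.1
  · intro B hB a ha
    rw [key]
    exact ⟨h.of_mem B hB.1 a ha, hB.2⟩
  · intro a b ha hab
    by_contra hb
    obtain ⟨B, hB⟩ := Option.ne_none_iff_exists'.1 hb
    rw [key] at hB
    split_ifs at ha with ha'
    · exact hch B ((h.adj_iff _ _).2 ⟨hB.2.symm, a, b, ha', hB.1, hab⟩)
    · rw [h.none_of_adj a b ha hab] at hB
      simp at hB
  · intro B C
    change (B ≠ A ∧ C ≠ A ∧ B ≠ C ∧ (K.Adj B C ∨ (K.Adj B A ∧ K.Adj A C))) ↔ _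
    simp only [key]
    constructor
    · rintro ⟨h1, h2, h3, h4 | h4⟩
      · obtain ⟨-, a, b, ha, hb, hab⟩ := (h.adj_iff _ _).1 h4
        exact ⟨h3, a, b, ⟨ha, h1⟩, ⟨hb, h2⟩, hab⟩
      · exact absurd h4.2 (hch C)
    · rintro ⟨h3, a, b, ⟨ha, h1⟩, ⟨hb, h2⟩, hab⟩
      exact ⟨h1, h2, h3, Or.inl ((h.adj_iff _ _).2 ⟨h3, a, b, ha, hb, hab⟩)⟩
  · intro a b B C hB haB hab hC
    rw [key] at hB hC
    exact h.eq_of_notMem a b B C hB.1 haB hab hC.1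

/-- What `A` owned passes to its only child `B`. These nodes have no edges to owners other than `A`
and `B`, so as new non-members of `B` they respect the invariant; edges into `A` turn into the edges
to `B` that the deletion adds. -/
theorem IsOwner.delete_of_child {G : DAG N} {K : ClusterGraph N} {own : N → Option (Set N)}
    (h : IsOwner G K own) {A B : Set N} (hA : A ∈ K.nodes) (hAB : K.Adj A B)
    (hch : ∀ C, K.Adj A C → C = B) :
    ∃ own', IsOwner G (K.delete A) own' := by
  classical
  obtain ⟨hne, a₀, b₀, ha₀, hb₀, hab₀⟩ := (h.adj_iff _ _).1 hAB
  have hB := h.mem_nodes _ _ hb₀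
  have key : ∀ a C, (if own a = some A then some B else own a) = some C ↔
      C ≠ A ∧ (own a = some C ∨ (own a = some A ∧ C = B)) := by
    intro a C
    split_ifs with ha
    · simp only [ha, Option.some.injEq, true_and]
      constructor
      · rintro rfl; exact ⟨hne.symm, Or.inr rfl⟩
      · rintro ⟨h1, h2 | h2⟩
        · exact absurd h2.symm h1
        · exact h2.symm
    · simp only [ha, false_and, or_false]
      refine ⟨fun hC => ⟨?_, hC⟩, fun hC => hC.2⟩
      rintro rfl; exact ha hC
  refine ⟨fun a => if own a = some A then some B else own a, ?_⟩
  constructor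
  · intro a C hC
    rw [key] at hC
    refine ⟨?_, hC.1⟩
    rcases hC.2 with h2 | h2
    · exact h.mem_nodes _ _ h2
    · exact h2.2 ▸ hB
  · exact fun C hC => h.nonempty C hC.1
  · intro C hC a ha
    rw [key]
    exact ⟨hC.2, Or.inl (h.of_mem C hC.1 a ha)⟩
  · intro a b ha hab
    split_ifs at ha with ha'
    simp [h.none_of_adj a b ha hab]
  · intro C D
    change (C ≠ A ∧ D ≠ A ∧ C ≠ D ∧ (K.Adj C D ∨ (K.Adj C A ∧ K.Adj A D))) ↔ _
    simp only [key]
    constructor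
    · rintro ⟨h1, h2, h3, h4 | ⟨h4, h5⟩⟩
      · obtain ⟨-, a, b, ha, hb, hab⟩ := (h.adj_iff _ _).1 h4
        exact ⟨h3, a, b, ⟨h1, Or.inl ha⟩, ⟨h2, Or.inl hb⟩, hab⟩
      · obtain ⟨-, a, b, ha, hb, hab⟩ := (h.adj_iff _ _).1 h4
        exact ⟨h3, a, b, ⟨h1, Or.inl ha⟩, ⟨h2, Or.inr ⟨hb, hch D h5⟩⟩, hab⟩
    · rintro ⟨h3, a, b, ⟨h1, ha⟩, ⟨h2, hb⟩, hab⟩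
      refine ⟨h1, h2, h3, ?_⟩
      rcases ha with ha | ⟨ha, hC⟩ <;> rcases hb with hb | ⟨hb, hD⟩
      · exact Or.inl ((h.adj_iff _ _).2 ⟨h3, a, b, ha, hb, hab⟩)
      · exact Or.inr ⟨(h.adj_iff _ _).2 ⟨h1, a, b, ha, hb, hab⟩, hD ▸ hAB⟩
      · exact absurd (hC.trans (hch D ((h.adj_iff _ _).2 ⟨h2.symm, a, b, ha, hb, hab⟩)).symm) h3
      · exact absurd (hC.trans hD.symm) h3
  · intro a b C D hC haC hab hD
    rw [key] at hC hD
    obtain ⟨h1, hC⟩ := hC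
    obtain ⟨h2, hD⟩ := hD
    rcases hC with hC | ⟨ha, hC⟩ <;> rcases hD with hD | ⟨hb, hD⟩
    · exact h.eq_of_notMem a b C D hC haC hab hD
    · exact absurd (h.eq_of_notMem a b C A hC haC hab hb).symm h1
    · exact (hch D ((h.adj_iff _ _).2 ⟨h2.symm, a, b, ha, hD, hab⟩)).trans hC.symm
    · exact hD.trans hC.symm

/-- Replacing a cluster by a larger one only shrinks its set of owned non-members, so the invariant
survives composition with `mergeMap`. -/
theorem IsOwner.merge {G : DAG N} {K : ClusterGraph N} {own : N → Option (Set N)}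
    (h : IsOwner G K own) {A B : Set N} (hA : A ∈ K.nodes) (hB : B ∈ K.nodes) :
    IsOwner G (K.merge A B) fun a => (own a).map (mergeMap A B) := by
  have sub : ∀ E, E ⊆ mergeMap A B E := by
    intro E
    unfold mergeMap
    split_ifs with hE
    · rcases hE with rfl | rfl
      exacts [Set.subset_union_left, Set.subset_union_right]
    · exact subset_rfl
  have nonempty' : ∀ A' ∈ (K.merge A B).nodes, A'.Nonempty := by
    rintro _ ⟨E, hE, rfl⟩
    exact (h.nonempty E hE).mono (sub E)
  have of_mem' : ∀ A' ∈ (K.merge A B).nodes, ∀ a ∈ A',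
      (own a).map (mergeMap A B) = some A' := by
    rintro _ ⟨E, hE, rfl⟩ a ha
    by_cases hEAB : E = A ∨ E = B
    · have hm : mergeMap A B E = A ∪ B := if_pos hEAB
      rw [hm] at ha ⊢
      rcases ha with ha | ha
      · rw [h.of_mem A hA a ha, Option.map_some, mergeMap, if_pos (Or.inl rfl)]
      · rw [h.of_mem B hB a ha, Option.map_some, mergeMap, if_pos (Or.inr rfl)]
    · have hm : mergeMap A B E = E := if_neg hEAB
      rw [hm] at ha
      rw [h.of_mem E hE a ha, Option.map_some]
  refine ⟨?_, nonempty', of_mem', ?_, ?_, ?_⟩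
  · intro a A' ha
    obtain ⟨E, hE, rfl⟩ := Option.map_eq_some_iff.1 ha
    exact ⟨E, h.mem_nodes a E hE, rfl⟩
  · intro a b ha hab
    simp only [Option.map_eq_none_iff] at ha ⊢
    exact h.none_of_adj a b ha hab
  · intro C D
    change (C ≠ D ∧ ∃ C₀ D₀, K.Adj C₀ D₀ ∧ mergeMap A B C₀ = C ∧ mergeMap A B D₀ = D) ↔ _
    simp only [Option.map_eq_some_iff]
    constructor
    · rintro ⟨hne, C₀, D₀, hadj, hC, hD⟩
      obtain ⟨-, a, b, ha, hb, hab⟩ := (h.adj_iff _ _).1 hadj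
      exact ⟨hne, a, b, ⟨C₀, ha, hC⟩, ⟨D₀, hb, hD⟩, hab⟩
    · rintro ⟨hne, a, b, ⟨C₀, ha, hC⟩, ⟨D₀, hb, hD⟩, hab⟩
      refine ⟨hne, C₀, D₀, (h.adj_iff _ _).2 ⟨?_, a, b, ha, hb, hab⟩, hC, hD⟩
      rintro rfl
      exact hne (hC.symm.trans hD)
  · intro a b C D hC haC hab hD
    obtain ⟨C₀, hC₀, rfl⟩ := Option.map_eq_some_iff.1 hC
    obtain ⟨D₀, hD₀, rfl⟩ := Option.map_eq_some_iff.1 hD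
    rw [h.eq_of_notMem a b C₀ D₀ hC₀ (fun ha => haC (sub _ ha)) hab hD₀]

theorem Reachable.exists_isOwner {G : DAG N} {K : ClusterGraph N} (h : Reachable G K) :
    ∃ own, IsOwner G K own := by
  induction h with
  | start => exact ⟨_, .ofDAG G⟩
  | @delete K A _ hA hch ih =>
    obtain ⟨own, ih⟩ := ih
    by_cases hB : ∃ B, K.Adj A B
    · obtain ⟨B, hB⟩ := hB
      exact ih.delete_of_child hA hB fun C hC => hch C B hC hB
    · exact ih.delete_childless hA (not_exists.1 hB)
  | merge _ hA hB _ ih =>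
    obtain ⟨own, ih⟩ := ih
    exact ⟨_, ih.merge hA hB⟩

end ClusterGraph

/-- In a graphical abstraction each node of `G` is absorbed by at most one node of `H`. -/
theorem IsGraphicalAbstraction.exists_owner {N : Type u} {N' : Type v} {G : DAG N} {H : DAG N'}
    {c : N' → Set N} (h : IsGraphicalAbstraction G H c) :
    ∃ own : N → Option N', (∀ A, ∀ a ∈ c A, own a = some A) ∧
      (∀ a b, own a = none → G.Adj a b → own b = none) ∧
      (∀ a b A B, own a = some A → own b = some B → G.Adj a b → A = B ∨ (a ∈ c A ∧ H.Adj A B)) := by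
  obtain ⟨K, hK, hinj, hrange, hadj⟩ := h
  obtain ⟨own, hown⟩ := hK.exists_isOwner
  have hex : ∀ a A, own a = some A → ∃ A', c A' = A := fun a A hA => by
    have := hown.mem_nodes a A hA
    rwa [← hrange] at this
  have hpre : ∀ a, ∃ o : Option N', o.map c = own a := by
    intro a
    cases ho : own a with
    | none => exact ⟨none, rfl⟩
    | some A =>
      obtain ⟨A', rfl⟩ := hex a A ho
      exact ⟨some A', rfl⟩
  choose own' hown' using hpre
  have key : ∀ a A, own' a = some A ↔ own a = some (c A) := by
    intro a A
    rw [← hown']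
    constructor
    · intro h; rw [h]; rfl
    · intro h
      obtain ⟨B, hB, hBA⟩ := Option.map_eq_some_iff.1 h
      rw [hB, hinj hBA]
  have key0 : ∀ a, own' a = none ↔ own a = none := by
    intro a
    rw [← hown', Option.map_eq_none_iff]
  refine ⟨own', ?_, ?_, ?_⟩
  · intro A a ha
    rw [key]
    exact hown.of_mem _ (hrange ▸ ⟨A, rfl⟩) a ha
  · intro a b
    rw [key0, key0]
    exact hown.none_of_adj a b
  · intro a b A B ha hb hab
    rw [key] at ha hb
    by_cases hAB : A = B
    · exact Or.inl hAB
    · refine Or.inr ⟨?_, ?_⟩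
      · by_contra hmem
        exact hAB (hinj (hown.eq_of_notMem a b _ _ ha hmem hab hb)).symm
      · rw [hadj, hown.adj_iff]
        exact ⟨hinj.ne hAB, a, b, ha, hb, hab⟩

/-! ### From latent projections to roles -/

/-- Exogenous nodes have no incoming edges, so none can be an intermediate node of a path. -/
theorem DAG.HasLatentProjection.latentPath_iff {V : Type u} {U : Type v} {G : DAG (V ⊕ U)}
    {L : ADMG V} (h : G.HasLatentProjection L) (a b : V ⊕ U) : G.LatentPath a b ↔ G.Adj a b := by
  refine ⟨fun hab => ?_, .edge⟩
  cases hab with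
  | edge hab => exact hab
  | cons hal _ => exact absurd hal (h.exogenous _ _)

theorem DAG.HasLatentProjection.adj_iff {V : Type u} {U : Type v} {G : DAG (V ⊕ U)}
    {L : ADMG V} (h : G.HasLatentProjection L) (a b : V) :
    L.Adj a b ↔ G.Adj (Sum.inl a) (Sum.inl b) := by
  rw [h.dir_iff, h.latentPath_iff]

theorem DAG.HasLatentProjection.bi_iff_adj {V : Type u} {U : Type v} {G : DAG (V ⊕ U)}
    {L : ADMG V} (h : G.HasLatentProjection L) (a b : V) :
    L.bi a b ↔ a ≠ b ∧ ∃ l : U, G.Adj (Sum.inr l) (Sum.inl a) ∧ G.Adj (Sum.inr l) (Sum.inl b) := by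
  simp only [h.bi_iff, h.latentPath_iff]

section Abstraction

variable {V : Type u} {U : Type v} {W : Type w} {L : ADMG V} {H : ADMG W} {cl : W → Set V}

/-- A graphical abstraction between ADMGs assigns the endogenous nodes to the nodes of `H` and to
finitely many latent blocks. The conditions on latent variables are stated in terms of the
bidirected edges of `L`, hence apply to every DAG with latent projection `L`. -/
theorem IsADMGAbstraction.exists_owner (hH : IsADMGAbstraction L H cl) :
    ∃ (n : ℕ) (own : V → Option (W ⊕ Fin n)) (src : Fin n → W → Prop),
      (∀ C, ∀ a ∈ cl C, own a = some (Sum.inl C)) ∧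
      (∀ a b, own a = none → L.Adj a b → own b = none) ∧
      (∀ a b C D, own a = some (Sum.inl C) → own b = some (Sum.inl D) → L.Adj a b →
        C = D ∨ (a ∈ cl C ∧ H.Adj C D)) ∧
      (∀ a b j, own b = some (Sum.inr j) → L.Adj a b → own a = some (Sum.inr j)) ∧
      (∀ a b j C, own a = some (Sum.inr j) → own b = some (Sum.inl C) → L.Adj a b ∨ L.bi a b →
        src j C) ∧
      (∀ a b j k, own a = some (Sum.inr j) → own b = some (Sum.inr k) → L.bi a b → j = k) ∧
      (∀ a b C D, C ≠ D → own a = some (Sum.inl C) → own b = some (Sum.inl D) → L.bi a b →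
        H.bi C D) ∧
      ∀ C D, H.bi C D ↔ C ≠ D ∧ ∃ j, src j C ∧ src j D := by
  obtain ⟨m, n, L', H', c, hL', hH', habs, hc⟩ := hH
  obtain ⟨own, hmem, hnone, hadj⟩ := habs.exists_owner
  -- An exogenous node of `H'` has no parents, so nothing with another owner, or with none, can
  -- point into what it owns.
  have root : ∀ a b j, own b = some (Sum.inr j) → L'.Adj a b → own a = some (Sum.inr j) := by
    intro a b j hb hab
    rcases ha : own a with _ | A
    · rw [hnone a b ha hab] at hb
      simp at hb
    · rcases hadj a b A _ ha hb hab with rfl | h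
      · rfl
      · exact absurd h.2 (hH'.exogenous _ _)
  -- An exogenous `l` cannot be owned by a different endogenous `D`: only members of `D` have edges
  -- to other owners, and these members are endogenous.
  have latent : ∀ (l : Fin m) b C, own b = some (Sum.inl C) → L'.Adj (Sum.inr l) b →
      own (Sum.inr l) = some (Sum.inl C) ∨
        ∃ j, own (Sum.inr l) = some (Sum.inr j) ∧ H'.Adj (Sum.inr j) (Sum.inl C) := by
    intro l b C hb hlb
    rcases hl : own (Sum.inr l) with _ | D | j
    · rw [hnone _ b hl hlb] at hb
      simp at hb
    · rcases hadj _ b _ _ hl hb hlb with h | h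
      · rw [h]; exact Or.inl rfl
      · rw [hc] at h
        simp at h
    · rcases hadj _ b _ _ hl hb hlb with h | h
      · simp at h
      · exact Or.inr ⟨j, rfl, h.2⟩
  refine ⟨n, fun a => own (Sum.inl a), fun j C => H'.Adj (Sum.inr j) (Sum.inl C), ?_, ?_, ?_, ?_,
    ?_, ?_, ?_, hH'.bi_iff_adj⟩
  · exact fun C a ha => hmem _ _ (by rw [hc]; exact ⟨a, ha, rfl⟩)
  · exact fun a b ha hab => hnone _ _ ha ((hL'.adj_iff a b).1 hab)
  · intro a b C D ha hb hab
    rcases hadj _ _ _ _ ha hb ((hL'.adj_iff a b).1 hab) with h | ⟨h1, h2⟩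
    · exact Or.inl (Sum.inl_injective h)
    · rw [hc] at h1
      obtain ⟨a', ha', h1⟩ := h1
      exact Or.inr ⟨Sum.inl_injective h1 ▸ ha', (hH'.adj_iff C D).2 h2⟩
  · exact fun a b j hb hab => root _ _ j hb ((hL'.adj_iff a b).1 hab)
  · rintro a b j C ha hb (hab | hab)
    · rcases hadj _ _ _ _ ha hb ((hL'.adj_iff a b).1 hab) with h | h
      · simp at h
      · exact h.2
    · obtain ⟨-, l, hla, hlb⟩ := (hL'.bi_iff_adj a b).1 hab
      have hl := root _ _ j ha hla
      rcases latent l _ C hb hlb with h | ⟨k, hk, h⟩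
      · rw [hl] at h
        simp at h
      · rw [hl] at hk
        obtain rfl : j = k := by simpa using hk
        exact h
  · intro a b j k ha hb hab
    obtain ⟨-, l, hla, hlb⟩ := (hL'.bi_iff_adj a b).1 hab
    have := (root _ _ j ha hla).symm.trans (root _ _ k hb hlb)
    simpa using this
  · intro a b C D hne ha hb hab
    obtain ⟨-, l, hla, hlb⟩ := (hL'.bi_iff_adj a b).1 hab
    -- The common source `l` has a single owner. As `C ≠ D`, this must be an exogenous node of `H'`,
    -- and it points to both.
    rcases latent l _ C ha hla with h | ⟨j, hj, h⟩ <;>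
      rcases latent l _ D hb hlb with h' | ⟨k, hk, h'⟩
    · exact absurd (by simpa using h.symm.trans h') hne
    · simp [h] at hk
    · simp [h'] at hj
    · obtain rfl : j = k := by simpa using hj.symm.trans hk
      exact (hH'.bi_iff_adj C D).2 ⟨hne, j, h, h'⟩

/-- Every DAG with latent projection `L` has cluster roles whose latent blocks are shared exactly
along the bidirected edges of `H`. -/
theorem IsADMGAbstraction.exists_clusterRoles (hH : IsADMGAbstraction L H cl) {G : DAG (V ⊕ U)}
    (hG : G.HasLatentProjection L) :
    ∃ (n : ℕ) (R : ClusterRoles G H cl (ULift.{w} (Fin n ⊕ U))),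
      ∀ C D : W, C ≠ D → ((R.lat C ∩ R.lat D).Nonempty ↔ H.bi C D) := by
  classical
  obtain ⟨n, own, src, hmem, hnone, hadj, hroot, hsrc, hblock, hbi, hbi_iff⟩ := hH.exists_owner
  let φ : W ⊕ Fin n → ULift.{w} (Fin n ⊕ U) ⊕ W :=
    Sum.elim Sum.inr fun j => Sum.inl (ULift.up (Sum.inl j))
  -- An exogenous `u` with a child in block `j` joins that block, which keeps blocks closed under
  -- parents; otherwise it forms a block of its own. The choice of `j` is unambiguous, since two
  -- children of `u` are joined by a bidirected edge of `L`.
  let role : V ⊕ U → Option (ULift.{w} (Fin n ⊕ U) ⊕ W) := Sum.elim (fun a => (own a).map φ)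
    fun u => if h : ∃ j a, G.Adj (Sum.inr u) (Sum.inl a) ∧ own a = some (Sum.inr j) then
      some (Sum.inl (ULift.up (Sum.inl h.choose))) else some (Sum.inl (ULift.up (Sum.inr u)))
  have role_none : ∀ a, role (Sum.inl a) = none ↔ own a = none := fun a => by simp [role]
  have role_cluster : ∀ a C, role (Sum.inl a) = some (Sum.inr C) ↔ own a = some (Sum.inl C) := by
    intro a C
    simp [role, φ]
  have role_block : ∀ a i, role (Sum.inl a) = some (Sum.inl i) ↔
      ∃ j, own a = some (Sum.inr j) ∧ i = ULift.up (Sum.inl j) := by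
    intro a i
    simp [role, φ, eq_comm]
  have role_latent : ∀ u, (∃ j a, role (Sum.inr u) = some (Sum.inl (ULift.up (Sum.inl j))) ∧
      G.Adj (Sum.inr u) (Sum.inl a) ∧ own a = some (Sum.inr j)) ∨
      (role (Sum.inr u) = some (Sum.inl (ULift.up (Sum.inr u))) ∧
        ¬ ∃ j a, G.Adj (Sum.inr u) (Sum.inl a) ∧ own a = some (Sum.inr j)) := by
    intro u
    by_cases h : ∃ j a, G.Adj (Sum.inr u) (Sum.inl a) ∧ own a = some (Sum.inr j)
    · obtain ⟨a, ha⟩ := h.choose_spec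
      exact Or.inl ⟨h.choose, a, by simp only [role, Sum.elim_inr, dif_pos h], ha⟩
    · exact Or.inr ⟨by simp only [role, Sum.elim_inr, dif_neg h], h⟩
  have bi_or : ∀ u a b, G.Adj (Sum.inr u) (Sum.inl a) → G.Adj (Sum.inr u) (Sum.inl b) →
      a = b ∨ L.bi a b := by
    intro u a b ha hb
    by_cases hab : a = b
    · exact Or.inl hab
    · exact Or.inr ((hG.bi_iff_adj a b).2 ⟨hab, u, ha, hb⟩)
  -- Block `j` is attached to `C` whenever `src j C`, even if no node of `G` lies in it: an empty
  -- block may be needed to witness a bidirected edge of `H`.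
  refine ⟨n, ⟨role, fun C => {i | (∃ j, i = ULift.up (Sum.inl j) ∧ src j C) ∨
    ∃ u a, i = ULift.up (Sum.inr u) ∧ G.Adj (Sum.inr u) (Sum.inl a) ∧ own a = some (Sum.inl C)},
    ?_, ?_, ?_, ?_, ?_⟩, ?_⟩
  · exact fun C a ha => (role_cluster a C).2 (hmem C a ha)
  · rintro a (b | u) i hb hab
    · obtain ⟨j, hj, rfl⟩ := (role_block b i).1 hb
      rcases a with a | u
      · exact (role_block a _).2 ⟨j, hroot a b j hj ((hG.adj_iff a b).2 hab), rfl⟩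
      · rcases role_latent u with ⟨k, a, hu, hua, ha⟩ | ⟨-, hu⟩
        · rcases bi_or u a b hua hab with rfl | h
          · rw [ha] at hj
            obtain rfl : k = j := by simpa using hj
            exact hu
          · exact hblock a b k j ha hj h ▸ hu
        · exact absurd ⟨j, b, hab, hj⟩ hu
    · exact absurd hab (hG.exogenous _ _)
  · rintro a (b | u) i C ha hb hab
    · rw [role_cluster] at hb
      rcases a with a | u
      · obtain ⟨j, hj, rfl⟩ := (role_block a i).1 ha
        exact Or.inl ⟨j, rfl, hsrc a b j C hj hb (Or.inl ((hG.adj_iff a b).2 hab))⟩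
      · rcases role_latent u with ⟨j, a, hu, hua, hj⟩ | ⟨hu, -⟩
        · obtain rfl : ULift.up (Sum.inl j) = i := by simpa using hu.symm.trans ha
          refine Or.inl ⟨j, rfl, hsrc a b j C hj hb (Or.inr ?_)⟩
          rcases bi_or u a b hua hab with rfl | h
          · simp [hj] at hb
          · exact h
        · obtain rfl : ULift.up (Sum.inr u) = i := by simpa using hu.symm.trans ha
          exact Or.inr ⟨u, b, rfl, hab, hb⟩
    · exact absurd hab (hG.exogenous _ _)
  · rintro (a | u) (b | u') C D ha hb hab
    · rw [role_cluster] at ha hb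
      rcases hadj a b C D ha hb ((hG.adj_iff a b).2 hab) with h | ⟨h1, h2⟩
      · exact Or.inl h
      · exact Or.inr ⟨⟨a, h1, rfl⟩, h2⟩
    · exact absurd hab (hG.exogenous _ _)
    · rcases role_latent u with ⟨j, a, hu, -⟩ | ⟨hu, -⟩ <;> simp [hu] at ha
    · exact absurd hab (hG.exogenous _ _)
  · rintro (a | u) (b | u') ha hab
    · rw [role_none] at ha ⊢
      exact hnone a b ha ((hG.adj_iff a b).2 hab)
    · exact absurd hab (hG.exogenous _ _)
    · rcases role_latent u with ⟨j, a, hu, -⟩ | ⟨hu, -⟩ <;> simp [hu] at ha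
    · exact absurd hab (hG.exogenous _ _)
  · intro C D hne
    constructor
    · rintro ⟨i, ⟨j, rfl, hC⟩ | ⟨u, a, rfl, hua, ha⟩, ⟨k, hk, hD⟩ | ⟨u', b, hu, hub, hb⟩⟩
      · obtain rfl : j = k := by simpa using hk
        exact (hbi_iff C D).2 ⟨hne, j, hC, hD⟩
      · simp at hu
      · simp at hk
      · obtain rfl : u = u' := by simpa using hu
        -- A source `u` shared by two clusters gives a bidirected edge of `L` between them, hence
        -- one of `H`.
        rcases bi_or u a b hua hub with rfl | h
        · exact absurd (by simpa using ha.symm.trans hb) hne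
        · exact hbi a b C D hne ha hb h
    · intro h
      obtain ⟨-, j, hC, hD⟩ := (hbi_iff C D).1 h
      exact ⟨_, Or.inl ⟨j, rfl, hC⟩, Or.inl ⟨j, rfl, hD⟩⟩

end Abstraction

theorem mainTheorem4 {V : Type u} {U : Type v} {W : Type w} [Finite V] [Finite U] [Finite W]
    (X : V ⊕ U → Type x) [∀ a, MeasurableSpace (X a)]
    (L' : DAG (V ⊕ U)) (M : CBN L' X) (L : ADMG V) (hL : L'.HasLatentProjection L)
    (H : ADMG W) (cl : W → Set V) (hH : IsADMGAbstraction L H cl) :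
    ∃ F : ADMG.LatentModel.{w, max v w, max u v x, max u x} H
        (fun C => ∀ a : cl C, X (Sum.inl a)),
      (∀ C C' : W, C ≠ C' → ((F.lat C ∩ F.lat C').Nonempty ↔ H.bi C C')) ∧
      ∀ (S : Set W) (z : ∀ a, X a)
        (E : Set (∀ C : (Sᶜ : Set W), ∀ a : cl C, X (Sum.inl a))), MeasurableSet E →
        (M.doDist (⋃ C ∈ S, Sum.inl '' cl C) z).map
            (fun y (C : (Sᶜ : Set W)) (a : cl C) => y (Sum.inl a)) E =
          ∫⁻ y, ((F.atLatent y).doDist S (fun C a => z (Sum.inl a))).map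
            (fun t (C : (Sᶜ : Set W)) => t C) E ∂F.latentLaw := by
  obtain ⟨n, R, hR⟩ := hH.exists_clusterRoles hL
  -- The model must be fixed before `S` and `z`, so its kernels start from a reference state whose
  -- values do not matter.
  obtain ⟨z₀⟩ := M.nonempty_states
  have := Fintype.ofFinite (ULift.{w} (Fin n ⊕ U))
  exact ⟨R.latentModel M z₀, hR, fun S z E hE => R.doDist_map_apply M z₀ S z hE⟩
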